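/- Let $\Sigma$ be a vocabulary of predicate and constant symbols. For a structure $\mathcal I$ with (nonempty, possibly infinite) domain $D$, a domain atom is an expression $P(\overline d)$ with $P\in\Sigma$ a predicate symbol and $\overline d$ a tuple over $D$; $\mathcal I$ is identified with the set of domain atoms true in it, and constants are interpreted as in $\mathcal I$. **Programs.** An E-disjunctive program $\mathcal P$ is a finite set of rules $$\forall \overline x:\exists\overline y:\ \alpha_1;\dots;\alpha_m \ \text{:-}\ \beta_1,\dots,\beta_k,\ \text{not}\,\gamma_1,\dots,\text{not}\,\gamma_n ,$$ where $m,k,n\ge 0$, the $\alpha_i,\beta_i,\gamma_i$ are atoms over $\Sigma$ with variables among $\overline x,\overline y$, and variables of $\overline y$ occur only in the $\alpha_i$. A rule is *disjunctive* if $\overline y$ is not empty or $m>1$. The structure $\mathcal I$ is a *stable model* of $\mathcal P$ if $\mathcal I$ is a $\subseteq$-minimal set $X$ of domain atoms with this property: for every rule of $\mathcal P$ and every assignment $\eta$ of $\overline x$, if $X\cup\{\lnot\delta \mid \delta \text{ a domain atom},\ \delta\notin\mathcal I\}$ logically entails the body of the rule under $\eta$, then $\alpha_i\eta\theta\in X$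 for some $i$ and some assignment $\theta$ of $\overline y$. A domain atom $\delta$ *occurs in* a rule $r$ at $i$ for an assignment $\eta$ of $\overline x,\overline y$ if $\alpha_i\eta=\delta$. $\mathcal P$ is *non-overlapping* over $\mathcal I$ if every domain atom $\delta$ either occurs only in non-disjunctive rules, or occurs in $r$ at $i$ for $\eta$ for at most one triple $(r,i,\eta)$ with $r\in\mathcal P$. $\mathcal P$ has *no recursion over negation* over $\mathcal I$ if no cycle of the following graph on domain atoms contains a negative edge: for every rule of $\mathcal P$ and all assignments $\eta,\theta$ of $\overline x,\overline y$, there are positive edges from each $\alpha_i\eta\theta$ to each $\beta_j\eta$, and negative edges from each $\alpha_i\eta\theta$ to each $\gamma_j\eta$. (In particular this holds if the dependency graph of $\mathcal P$ on predicate symbols has no cycle through a negative edge.) **FO(C-Log).** Creation-free causal effect expressions are built from atoms by $C\leftarrow\varphi$, $C_1\,\mathbf{And}\,C_2$, $C_1\,\mathbf{Or}\,C_2$, $\mathbf{All}\,x[\varphi]:C$ and $\mathbf{Select}\,x[\varphi]:C$, with $\varphi$ first-order formulas; a causal theory is such an expression without free variables. A predicate is endogenous in $C$ if it is the symbol of an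 atom-expression inside $C$, and exogenous otherwise. A selection $\zeta$ fixes, for each occurrence of a $\mathbf{Select}$- (resp. $\mathbf{Or}$-) expression and each instantiation of the variables in whose scope it occurs, an element of $D$ (resp. one of the two disjuncts). In a partial structure $(L,U)$ ($L$ the set of certainly true and $U$ the set of possibly true domain atoms) the effect set of an expression is $\{P(\overline t)\}$ for an atom $P(\overline t)$; that of $C$ if $\varphi$ is certainly true (in Kleene's three-valued sense), and $\emptyset$ otherwise, for $C\leftarrow\varphi$; the union for $\mathbf{And}$; that of the disjunct chosen by $\zeta$ for $\mathbf{Or}$; the union of those of $C(d)$ over all $d$ with $\varphi(d)$ certainly true for $\mathbf{All}$; that of $C(d)$ if $\varphi(d)$ is certainly true, and $\emptyset$ otherwise, with $d$ the element selected by $\zeta$, for $\mathbf{Select}$. Let $A_\zeta(L,U)$ be the union of this effect set and the exogenous atoms true in $\mathcal I$, and let $S_\zeta(U)$ be the least fixpoint of $L\mapsto A_\zeta(L,U)$. The well-founded fixpoint for $\zeta$ is the least fixpoint of $(L,U)\mapsto(S_\zeta(U),S_\zeta(L))$ in the precision order ($L$ grows, $U$ shrinks). $\mathcal I$ is a model of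 a causal theory if, for some selection $\zeta$, this fixpoint is $(\mathcal I,\mathcal I)$, and in $\mathcal I$ each $\mathbf{Select}$-expression that comes into play has selected an element satisfying its qualification. $\mathcal I$ is a model of an FO(C-Log) theory, i.e. of a set of causal theories and first-order sentences, if it is a model of each of its members. **Translation.** The theory $\mathcal T_{\mathcal P}$ consists of * the causal theory that is the $\mathbf{And}$-conjunction of all expressions $$\mathbf{All}\,\overline x\,[\beta_1\land\dots\land\beta_k\land\lnot\gamma_1\land\dots\land\lnot\gamma_n]:\ \mathbf{Select}\,\overline y\,[\mathbf t]:\ \alpha_1\,\mathbf{Or}\,(\dots\,\mathbf{Or}\,\alpha_m)$$ for the rules of $\mathcal P$ with $m>0$ (no causal theory if there are none), where $\mathbf{All}\,x_1,\dots,x_p[\varphi]:C$ stands for $\mathbf{All}\,x_1[\mathbf t]:\dots\mathbf{All}\,x_p[\varphi]:C$, and for $C\leftarrow\varphi$ if $p=0$; similarly for $\mathbf{Select}$, where $\mathbf{Select}\,\overline y[\mathbf t]:C$ is $C$ if $\overline y$ is empty; * the sentences $\forall\overline x:\lnot(\beta_1\land\dots\land\beta_k\land\lnot\gamma_1\land\dots\land\lnot\gamma_n)$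 for the rules of $\mathcal P$ with $m=0$; * the sentences $\forall\overline x:\lnot P(\overline x)$ for the predicate symbols $P$ of $\Sigma$ that do not occur in the head of any rule of $\mathcal P$. **Theorem.** Let $\mathcal P$ be an E-disjunctive program over $\Sigma$. For every structure $\mathcal I$ over which $\mathcal P$ is non-overlapping and has no recursion over negation, $\mathcal I$ is a stable model of $\mathcal P$ if and only if $\mathcal I$ is a model of $\mathcal T_{\mathcal P}$. -/

import Mathlib

/-!
Creation-free C-Log, FO(C-Log), E-disjunctive logic programs with their stable models, and the
translation of E-disjunctive programs into FO(C-Log) theories.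

Vocabularies, terms, first-order formulas and structures are Mathlib's.  In a syntactic object
indexed by `n`, the variables in scope are `Fin n`; a quantifier binds the new variable `n`.
-/

open FirstOrder

universe u v w

namespace CLog

/-- An atom `P(t₁, …, tₖ)` over the variables `Fin n`. -/
structure Atom (L : FirstOrder.Language.{u, v}) (n : ℕ) where
  arity : ℕ
  rel : L.Relations arity
  args : Fin arity → L.Term (Empty ⊕ Fin n)

/-- A domain atom `P(d₁, …, dₖ)`, with `dᵢ` elements of the domain `M`. -/
structure DomainAtom (L : FirstOrder.Language.{u, v}) (M : Type w) where
  arity : ℕ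
  rel : L.Relations arity
  args : Fin arity → M

/-- The set of domain atoms that are true in the structure `M`. -/
def trueAtoms (L : FirstOrder.Language.{u, v}) (M : Type w) [L.Structure M] : Set (DomainAtom L M) :=
  {δ | FirstOrder.Language.Structure.RelMap δ.rel δ.args}

/-- An atom as a first-order formula. -/
def Atom.toFormula {L : FirstOrder.Language.{u, v}} {n : ℕ} (a : Atom L n) : L.BoundedFormula Empty n :=
  a.rel.boundedFormula a.args

section Expressions

/-- Creation-free causal effect expressions whose free variables are among `Fin n`. -/
inductive CEE (L : FirstOrder.Language.{u, v}) : ℕ → Type (max u v)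
  /-- `P(t)` -/
  | atom {n : ℕ} (a : Atom L n) : CEE L n
  /-- `C ← φ` -/
  | rule {n : ℕ} (φ : L.BoundedFormula Empty n) (C : CEE L n) : CEE L n
  /-- `C₁ And C₂` -/
  | and {n : ℕ} (C₁ C₂ : CEE L n) : CEE L n
  /-- `C₁ Or C₂` -/
  | or {n : ℕ} (C₁ C₂ : CEE L n) : CEE L n
  /-- `All x [φ] : C` -/
  | all {n : ℕ} (φ : L.BoundedFormula Empty (n + 1)) (C : CEE L (n + 1)) : CEE L n
  /-- `Select x [φ] : C` -/
  | select {n : ℕ} (φ : L.BoundedFormula Empty (n + 1)) (C : CEE L (n + 1)) : CEE L n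

variable {L : FirstOrder.Language.{u, v}}

/-- The predicate symbol `R` is endogenous in `C`: it is the symbol of an atom-expression
inside `C`. -/
def CEE.Endogenous {k : ℕ} (R : L.Relations k) : {n : ℕ} → CEE L n → Prop
  | _, .atom a => (⟨k, R⟩ : (k : ℕ) × L.Relations k) = ⟨a.arity, a.rel⟩
  | _, .rule _ C => C.Endogenous R
  | _, .and C₁ C₂ => C₁.Endogenous R ∨ C₂.Endogenous R
  | _, .or C₁ C₂ => C₁.Endogenous R ∨ C₂.Endogenous R
  | _, .all _ C => C.Endogenous R
  | _, .select _ C => C.Endogenous R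

/-- `All x₁ [t] : … All xₙ [t] : C`. -/
def CEE.allTrue : (n : ℕ) → CEE L n → CEE L 0
  | 0, C => C
  | n + 1, C => CEE.allTrue n (.all ⊤ C)

/-- `All x₁, …, xₙ [φ] : C`, that is `All x₁ [t] : … All xₙ [φ] : C`; for the empty tuple this is
the rule `C ← φ`. -/
def CEE.allBlock : (n : ℕ) → L.BoundedFormula Empty n → CEE L n → CEE L 0
  | 0, φ, C => .rule φ C
  | n + 1, φ, C => CEE.allTrue n (.all φ C)

/-- `Select y₁, …, yₚ [t] : C`. -/
def CEE.selectBlock {n : ℕ} : (p : ℕ) → CEE L (n + p) → CEE L n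
  | 0, C => C
  | p + 1, C => CEE.selectBlock p (.select ⊤ C)

/-- `α₁ Or (α₂ Or (… αₘ))`, for the nonempty list `α₁, …, αₘ` with first element `a`. -/
def CEE.orList {n : ℕ} : Atom L n → List (Atom L n) → CEE L n
  | a, [] => .atom a
  | a, b :: l => .or (.atom a) (CEE.orList b l)

/-- The `And`-conjunction of the nonempty list of expressions with first element `C`. -/
def CEE.andList {n : ℕ} : CEE L n → List (CEE L n) → CEE L n
  | C, [] => C
  | C, D :: l => .and C (CEE.andList D l)

end Expressions

section Semantics

variable {L : FirstOrder.Language.{u, v}} {M : Type w} [L.Structure M]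

/-- The domain atom obtained from the atom `a` under the variable assignment `η`. -/
def Atom.inst {n : ℕ} (a : Atom L n) (η : Fin n → M) : DomainAtom L M :=
  ⟨a.arity, a.rel, fun i => (a.args i).realize (Sum.elim (default : Empty → M) η)⟩

/-- Kleene's three-valued truth.  The partial structure whose certainly true domain atoms are `A`
and whose possibly true domain atoms are `B` makes `φ` certainly true iff `Holds A B φ η`, and
possibly true iff `Holds B A φ η` (atoms in positive position are looked up in the first set,
atoms in negative position in the second one). -/
def Holds : (A B : Set (DomainAtom L M)) → {n : ℕ} → L.BoundedFormula Empty n →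
    (Fin n → M) → Prop
  | _, _, _, .falsum, _ => False
  | _, _, _, .equal t₁ t₂, η =>
      t₁.realize (Sum.elim (default : Empty → M) η) = t₂.realize (Sum.elim default η)
  | A, _, _, .rel R ts, η => Atom.inst ⟨_, R, ts⟩ η ∈ A
  | A, B, _, .imp φ ψ, η => Holds B A φ η → Holds A B ψ η
  | A, B, _, .all φ, η => ∀ d : M, Holds A B φ (Fin.snoc η d)

theorem Holds.mono {n : ℕ} (φ : L.BoundedFormula Empty n) :
    ∀ {A A' B B' : Set (DomainAtom L M)} {η : Fin n → M}, A ⊆ A' → B' ⊆ B →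
      Holds A B φ η → Holds A' B' φ η := by
  induction φ with
  | falsum => intro _ _ _ _ _ _ _ h; exact h
  | equal => intro _ _ _ _ _ _ _ h; exact h
  | rel => intro _ _ _ _ _ hA _ h; exact hA h
  | imp φ ψ ih₁ ih₂ =>
    intro _ _ _ _ _ hA hB h h'
    exact ih₂ hA hB (h (ih₁ hB hA h'))
  | all φ ih => intro _ _ _ _ _ hA hB h d; exact ih hA hB (h d)

/-- On a two-valued structure this is ordinary truth. -/
theorem holds_trueAtoms_iff {n : ℕ} (φ : L.BoundedFormula Empty n) :
    ∀ η : Fin n → M, Holds (trueAtoms L M) (trueAtoms L M) φ η ↔ φ.Realize default η := by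
  induction φ with
  | falsum => intro _; exact Iff.rfl
  | equal => intro _; exact Iff.rfl
  | rel => intro _; exact Iff.rfl
  | imp φ ψ ih₁ ih₂ => intro η; exact imp_congr (ih₁ η) (ih₂ η)
  | all φ ih => intro η; exact forall_congr' fun d => ih _

variable (M) in
/-- A selection: it fixes once and for all, for every occurrence of a `Select`-expression and every
instantiation of the variables in whose scope it occurs, the selected domain element, and for
every occurrence of an `Or`-expression and every such instantiation, the chosen disjunct
(`true` for the first one). -/
def Selection : {n : ℕ} → CEE L n → Type w
  | _, .atom _ => PUnit
  | _, .rule _ C => Selection C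
  | _, .and C₁ C₂ => Selection C₁ × Selection C₂
  | n, .or C₁ C₂ => ((Fin n → M) → Bool) × Selection C₁ × Selection C₂
  | _, .all _ C => Selection C
  | n, .select _ C => ((Fin n → M) → M) × Selection C

/-- The effect set of `C` for the selection `ζ`, in the partial structure with certainly true atoms
`A` and possibly true atoms `B`, under the variable assignment `η`. -/
def effect (A B : Set (DomainAtom L M)) : {n : ℕ} → (C : CEE L n) → Selection M C →
    (Fin n → M) → Set (DomainAtom L M)
  | _, .atom a, _, η => {a.inst η}
  | _, .rule φ C, ζ, η => {δ | Holds A B φ η ∧ δ ∈ effect A B C ζ η}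
  | _, .and C₁ C₂, ζ, η => effect A B C₁ ζ.1 η ∪ effect A B C₂ ζ.2 η
  | _, .or C₁ C₂, ζ, η =>
      bif ζ.1 η then effect A B C₁ ζ.2.1 η else effect A B C₂ ζ.2.2 η
  | _, .all φ C, ζ, η =>
      {δ | ∃ d : M, Holds A B φ (Fin.snoc η d) ∧ δ ∈ effect A B C ζ (Fin.snoc η d)}
  | _, .select φ C, ζ, η =>
      {δ | Holds A B φ (Fin.snoc η (ζ.1 η)) ∧ δ ∈ effect A B C ζ.2 (Fin.snoc η (ζ.1 η))}

theorem effect_mono {A A' B B' : Set (DomainAtom L M)} (hA : A ⊆ A') (hB : B' ⊆ B) {n : ℕ}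
    (C : CEE L n) : ∀ (ζ : Selection M C) (η : Fin n → M),
      effect A B C ζ η ⊆ effect A' B' C ζ η := by
  induction C with
  | atom a => intro _ _; exact le_rfl
  | rule φ C ih => rintro ζ η δ ⟨h, h'⟩; exact ⟨h.mono φ hA hB, ih ζ η h'⟩
  | and C₁ C₂ ih₁ ih₂ => intro ζ η; exact Set.union_subset_union (ih₁ _ η) (ih₂ _ η)
  | or C₁ C₂ ih₁ ih₂ =>
    intro ζ η
    simp only [effect]
    cases ζ.1 η
    · exact ih₂ _ η
    · exact ih₁ _ η
  | all φ C ih => rintro ζ η δ ⟨d, h, h'⟩; exact ⟨d, h.mono φ hA hB, ih ζ _ h'⟩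
  | select φ C ih => rintro ζ η δ ⟨h, h'⟩; exact ⟨h.mono φ hA hB, ih ζ.2 _ h'⟩

/-- Every `Select`-expression that comes into play in the structure `M`, for the selection `ζ`,
has selected an element that satisfies its qualification. -/
def SelectsProperly : {n : ℕ} → (C : CEE L n) → Selection M C → (Fin n → M) → Prop
  | _, .atom _, _, _ => True
  | _, .rule φ C, ζ, η => φ.Realize default η → SelectsProperly C ζ η
  | _, .and C₁ C₂, ζ, η => SelectsProperly C₁ ζ.1 η ∧ SelectsProperly C₂ ζ.2 η
  | _, .or C₁ C₂, ζ, η =>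
      bif ζ.1 η then SelectsProperly C₁ ζ.2.1 η else SelectsProperly C₂ ζ.2.2 η
  | _, .all φ C, ζ, η =>
      ∀ d : M, φ.Realize default (Fin.snoc η d) → SelectsProperly C ζ (Fin.snoc η d)
  | _, .select φ C, ζ, η =>
      φ.Realize default (Fin.snoc η (ζ.1 η)) ∧ SelectsProperly C ζ.2 (Fin.snoc η (ζ.1 η))

/-- One component of the partial immediate causality operator of the causal theory `C` for the
selection `ζ`: the exogenous symbols have their value in the structure `M`, and the endogenous
atoms are those that are caused.  The operator sends the partial structure with certainly true
atoms `A` and possibly true atoms `B` to the one with certainly true atoms `cause C ζ A B` and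
possibly true atoms `cause C ζ B A`. -/
def cause (C : CEE L 0) (ζ : Selection M C) (A B : Set (DomainAtom L M)) :
    Set (DomainAtom L M) :=
  {δ | δ ∈ trueAtoms L M ∧ ¬ C.Endogenous δ.rel} ∪ effect A B C ζ default

theorem cause_mono (C : CEE L 0) (ζ : Selection M C) {A A' B B' : Set (DomainAtom L M)}
    (hA : A ⊆ A') (hB : B' ⊆ B) : cause C ζ A B ⊆ cause C ζ A' B' :=
  Set.union_subset_union_right _ (effect_mono hA hB C ζ default)

/-- The stable operator: the least fixpoint of `cause C ζ · B`. -/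
def stableOp (C : CEE L 0) (ζ : Selection M C) (B : Set (DomainAtom L M)) :
    Set (DomainAtom L M) :=
  OrderHom.lfp ⟨fun A => cause C ζ A B, fun _ _ h => cause_mono C ζ h le_rfl⟩

theorem stableOp_anti (C : CEE L 0) (ζ : Selection M C) : Antitone (stableOp C ζ) :=
  fun _ _ h => OrderHom.lfp.mono fun _ => cause_mono C ζ le_rfl h

/-- The well-founded fixpoint of the partial immediate causality operator: the least fixpoint, in
the precision order, of the stable revision operator.  The first component holds the certainly
true atoms, the second one the possibly true atoms. -/
def wellFoundedFixpoint (C : CEE L 0) (ζ : Selection M C) :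
    Set (DomainAtom L M) × (Set (DomainAtom L M))ᵒᵈ :=
  OrderHom.lfp
    ⟨fun p => (stableOp C ζ (OrderDual.ofDual p.2), OrderDual.toDual (stableOp C ζ p.1)),
      fun _ _ h => Prod.mk_le_mk.2 ⟨stableOp_anti C ζ h.2, stableOp_anti C ζ h.1⟩⟩

variable (M) in
/-- The structure `M` is a model of the causal theory `C`: it is the (two-valued) final state of the
causal process for some selection. -/
def CEE.IsModel (C : CEE L 0) : Prop :=
  ∃ ζ : Selection M C,
    wellFoundedFixpoint C ζ = (trueAtoms L M, OrderDual.toDual (trueAtoms L M)) ∧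
      SelectsProperly C ζ default

end Semantics

/-- An FO(C-Log) theory: a set of causal theories and a set of first-order sentences. -/
structure FOCLogTheory (L : FirstOrder.Language.{u, v}) where
  causal : Set (CEE L 0)
  sentences : Set L.Sentence

/-- The structure `M` is a model of the FO(C-Log) theory `T`. -/
def FOCLogTheory.IsModel {L : FirstOrder.Language.{u, v}} (T : FOCLogTheory L) (M : Type w)
    [L.Structure M] : Prop :=
  (∀ C ∈ T.causal, C.IsModel M) ∧ ∀ φ ∈ T.sentences, φ.Realize M

/-- A rule `∀ x : ∃ y : α₁; …; αₘ :- β₁, …, βₖ, not γ₁, …, not γₙ`.  The variables `x` are the first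
`numX` ones, the variables `y` the `numY` next ones. -/
structure Rule (L : FirstOrder.Language.{u, v}) where
  numX : ℕ
  numY : ℕ
  head : List (Atom L (numX + numY))
  pos : List (Atom L numX)
  neg : List (Atom L numX)

/-- An E-disjunctive program: a finite set of rules. -/
abbrev Program (L : FirstOrder.Language.{u, v}) := Finset (Rule L)

section Programs

variable {L : FirstOrder.Language.{u, v}}

/-- A rule is disjunctive if `y` is not the empty tuple or its head has more than one atom. -/
def Rule.Disjunctive (r : Rule L) : Prop := r.numY ≠ 0 ∨ 1 < r.head.length

/-- The formula `β₁ ∧ … ∧ βₖ ∧ ¬γ₁ ∧ … ∧ ¬γₙ`. -/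
def Rule.bodyFormula (r : Rule L) : L.BoundedFormula Empty r.numX :=
  (r.pos.map Atom.toFormula ++ r.neg.map fun a => ∼a.toFormula).foldr (· ⊓ ·) ⊤

/-- `All x [β₁ ∧ … ∧ ¬γₙ] : Select y [t] : α₁ Or (… αₘ)`, for a rule with `m > 0`. -/
def Rule.toCEE (r : Rule L) : Option (CEE L 0) :=
  match r.head with
  | [] => none
  | a :: l => some (CEE.allBlock r.numX r.bodyFormula (CEE.selectBlock r.numY (CEE.orList a l)))

/-- The symbol `R` occurs in the head of a rule of `P`. -/
def Program.InHead (P : Program L) {k : ℕ} (R : L.Relations k) : Prop :=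
  ∃ r ∈ P, ∃ a ∈ r.head, (⟨k, R⟩ : (k : ℕ) × L.Relations k) = ⟨a.arity, a.rel⟩

/-- The FO(C-Log) theory corresponding to `P`.  The causal theory is absent if no rule of `P` has a
nonempty head. -/
noncomputable def Program.toTheory (P : Program L) : FOCLogTheory L where
  causal :=
    match P.toList.filterMap Rule.toCEE with
    | [] => ∅
    | C :: l => {CEE.andList C l}
  sentences :=
    {φ | ∃ r ∈ P, r.head = [] ∧ φ = (∼r.bodyFormula).alls} ∪
    {φ | ∃ (k : ℕ) (R : L.Relations k), ¬ P.InHead R ∧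
      φ = (∼(R.boundedFormula fun i : Fin k =>
        (FirstOrder.Language.Term.var (Sum.inr i) : L.Term (Empty ⊕ Fin k)))).alls}

/-- The set of literals consisting of the atoms in `X` and the negations of the atoms not in `I`
logically entails the body of `r` under the assignment `η` of the variables `x`: the body is
true in every interpretation (set of true atoms) `Y` that satisfies all these literals. -/
def Rule.BodyEntailed {M : Type w} [L.Structure M] (r : Rule L) (X I : Set (DomainAtom L M))
    (η : Fin r.numX → M) : Prop :=
  ∀ Y : Set (DomainAtom L M), (∀ δ ∈ X, δ ∈ Y) → (∀ δ, δ ∉ I → δ ∉ Y) →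
    (∀ b ∈ r.pos, b.inst η ∈ Y) ∧ ∀ c ∈ r.neg, c.inst η ∉ Y

/-- The condition on `X` in the definition of stable models, for the candidate model `I`. -/
def Program.Closed {M : Type w} [L.Structure M] (P : Program L) (I X : Set (DomainAtom L M)) :
    Prop :=
  ∀ r ∈ P, ∀ η : Fin r.numX → M, r.BodyEntailed X I η →
    ∃ θ : Fin r.numY → M, ∃ a ∈ r.head, a.inst (Fin.append η θ) ∈ X

/-- The structure `M` is a stable model of the program `P`. -/
def Program.IsStableModel (P : Program L) (M : Type w) [L.Structure M] : Prop :=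
  Minimal (P.Closed (trueAtoms L M)) (trueAtoms L M)

/-- The domain atom `δ` occurs in (the head of) `r` at `i` for `η`. -/
def Rule.OccursAt {M : Type w} [L.Structure M] (r : Rule L) (δ : DomainAtom L M)
    (i : Fin r.head.length) (η : Fin (r.numX + r.numY) → M) : Prop :=
  (r.head.get i).inst η = δ

/-- The program `P` is non-overlapping with respect to the domain atoms of the structure `M`. -/
def Program.NonOverlapping (P : Program L) (M : Type w) [L.Structure M] : Prop :=
  ∀ δ : DomainAtom L M,
    (∀ r ∈ P, ∀ i η, r.OccursAt δ i η → ¬ r.Disjunctive) ∨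
    {o : (r : Rule L) × Fin r.head.length × (Fin (r.numX + r.numY) → M) |
      o.1 ∈ P ∧ o.1.OccursAt δ o.2.1 o.2.2}.Subsingleton

/-- `δ` depends positively on `ε`: in some instance of a rule of `P`, `δ` is in the head and `ε` is a
positive body atom. -/
def Program.PosDepends {M : Type w} [L.Structure M] (P : Program L) (δ ε : DomainAtom L M) :
    Prop :=
  ∃ r ∈ P, ∃ (η : Fin r.numX → M) (θ : Fin r.numY → M),
    (∃ a ∈ r.head, a.inst (Fin.append η θ) = δ) ∧ ∃ b ∈ r.pos, b.inst η = ε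

/-- `δ` depends negatively on `ε`: in some instance of a rule of `P`, `δ` is in the head and `ε` is a
negated body atom. -/
def Program.NegDepends {M : Type w} [L.Structure M] (P : Program L) (δ ε : DomainAtom L M) :
    Prop :=
  ∃ r ∈ P, ∃ (η : Fin r.numX → M) (θ : Fin r.numY → M),
    (∃ a ∈ r.head, a.inst (Fin.append η θ) = δ) ∧ ∃ c ∈ r.neg, c.inst η = ε

/-- No recursion over negation over the domain atoms of the structure `M`: no cycle of the
dependency graph passes through a negative dependency. -/
def Program.NoRecursionOverNegation (P : Program L) (M : Type w) [L.Structure M] : Prop :=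
  ∀ δ ε : DomainAtom L M, P.NegDepends δ ε →
    ¬ Relation.ReflTransGen (fun δ ε => P.PosDepends δ ε ∨ P.NegDepends δ ε) ε δ

end Programs

end CLog

namespace CLog

open Set

/-! ### Kleene truth of rule bodies, and entailment -/

section Structure

variable {L : FirstOrder.Language.{u, v}} {M : Type w} [L.Structure M]

/-! A selection for the translated theory amounts to a choice, for every instance of a rule with
nonempty head, of one head atom and of values for the existential variables
(`exists_choice_of_selection`, `exists_selection_of_choice`). The effect set is then the set
`chosenEffect` of atoms chosen by the instances with certainly true body. Let `T` be the set of true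
atoms.

If `T` is stable, choose a true head atom in each instance whose body is true. The stable operator
for this choice maps `T` to a closed subset of `T`, which is `T` by minimality. A fixpoint of the
stable operator need not be the well-founded one, and here the absence of recursion over negation
enters: it yields a rank in `ℕ` that strictly drops along negative edges (`exists_rank`). By
induction on the rank, possibly true atoms are certainly true (`wellFoundedFixpoint_eq`). An
infinite domain is no obstacle, since collapsing it to finitely many elements preserves the
dependency graph.

Conversely, in a model `T` is the least fixpoint of the chosen effects with negation evaluated in
`T`, so every true atom is chosen by some instance. If `X ⊆ T` is closed, each instance satisfied by
`X` has some head atom in `X`, and non-overlap forces the chosen head atom into `X`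
(`NonOverlapping.chosen_mem`). So `X` is closed under the chosen effects and contains `T`. The
first-order sentences account for rules with empty head and for exogenous predicates. -/

theorem holds_top (A B : Set (DomainAtom L M)) {n : ℕ} (η : Fin n → M) :
    Holds A B (⊤ : L.BoundedFormula Empty n) η :=
  fun h => h

theorem holds_not (A B : Set (DomainAtom L M)) {n : ℕ} (φ : L.BoundedFormula Empty n)
    (η : Fin n → M) : Holds A B (∼φ) η ↔ ¬ Holds B A φ η :=
  Iff.rfl

theorem holds_inf (A B : Set (DomainAtom L M)) {n : ℕ} (φ ψ : L.BoundedFormula Empty n)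
    (η : Fin n → M) : Holds A B (φ ⊓ ψ) η ↔ Holds A B φ η ∧ Holds A B ψ η := by
  -- Conjunction is encoded by nested implications; each conjunct is under two swaps of `A` and `B`,
  -- which cancel.
  change ((Holds A B φ η → Holds A B ψ η → False) → False) ↔ _
  tauto

theorem holds_toFormula (A B : Set (DomainAtom L M)) {n : ℕ} (a : Atom L n) (η : Fin n → M) :
    Holds A B a.toFormula η ↔ a.inst η ∈ A :=
  Iff.rfl

theorem holds_foldr_inf (A B : Set (DomainAtom L M)) {n : ℕ}
    (l : List (L.BoundedFormula Empty n)) (η : Fin n → M) :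
    Holds A B (l.foldr (· ⊓ ·) ⊤) η ↔ ∀ φ ∈ l, Holds A B φ η := by
  induction l with
  | nil => simpa using holds_top A B η
  | cons φ l ih => rw [List.foldr_cons, holds_inf, ih, List.forall_mem_cons]

theorem holds_bodyFormula (A B : Set (DomainAtom L M)) (r : Rule L) (η : Fin r.numX → M) :
    Holds A B r.bodyFormula η ↔ (∀ b ∈ r.pos, b.inst η ∈ A) ∧ ∀ c ∈ r.neg, c.inst η ∉ B := by
  simp only [Rule.bodyFormula, holds_foldr_inf, List.mem_append, List.mem_map, or_imp,
    forall_and, forall_exists_index, and_imp, forall_apply_eq_imp_iff₂, holds_not,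
    holds_toFormula]

/-- Since `X ⊆ I`, both sets satisfy the literals: `X` is the least such interpretation and tests
the positive atoms, `I` is the greatest and tests the negated ones. -/
theorem Rule.bodyEntailed_iff (r : Rule L) {X I : Set (DomainAtom L M)} (h : X ⊆ I)
    (η : Fin r.numX → M) : r.BodyEntailed X I η ↔ Holds X I r.bodyFormula η := by
  rw [holds_bodyFormula]
  constructor
  · intro H
    exact ⟨(H X (fun _ h => h) fun δ hδ hX => hδ (h hX)).1, (H I h fun _ h => h).2⟩
  · rintro ⟨hp, hn⟩ Y hX hI
    exact ⟨fun b hb => hX _ (hp b hb), fun c hc => hI _ (hn c hc)⟩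

/-! ### Effects of the building blocks of translated rules -/

/-- The nested Boolean choices single out one index, independently of the partial structure. -/
theorem exists_choice_of_orList {n : ℕ} (a : Atom L n) (l : List (Atom L n))
    (ζ : Selection M (CEE.orList a l)) :
    ∃ g : (Fin n → M) → Fin (a :: l).length, ∀ A B η,
      effect A B (CEE.orList a l) ζ η = {((a :: l).get (g η)).inst η} := by
  induction l generalizing a with
  | nil => exact ⟨fun _ => 0, fun _ _ _ => rfl⟩
  | cons b l ih =>
    obtain ⟨g, hg⟩ := ih b ζ.2.2
    refine ⟨fun η => bif ζ.1 η then 0 else (g η).succ, fun A B η => ?_⟩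
    simp only [CEE.orList, effect]
    cases ζ.1 η
    · exact hg A B η
    · rfl

theorem exists_selection_orList {n : ℕ} (a : Atom L n) (l : List (Atom L n))
    (g : (Fin n → M) → Fin (a :: l).length) :
    ∃ ζ : Selection M (CEE.orList a l), ∀ A B η,
      effect A B (CEE.orList a l) ζ η = {((a :: l).get (g η)).inst η} := by
  induction l generalizing a with
  | nil =>
    refine ⟨PUnit.unit, fun A B η => ?_⟩
    have : g η = 0 := Subsingleton.elim (α := Fin 1) _ _
    rw [this]
    rfl
  | cons b l ih =>
    -- The tail receives the predecessor of the index. The value at index `0` is a dummy: there the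
    -- first disjunct is taken.
    obtain ⟨ζ, hζ⟩ := ih b fun η => Fin.cases (motive := fun _ => Fin (b :: l).length)
      ⟨0, Nat.succ_pos _⟩ id (g η)
    refine ⟨(fun η => decide (g η = 0), PUnit.unit, ζ), fun A B η => ?_⟩
    have := hζ A B η
    simp only [CEE.orList, effect]
    rcases Fin.eq_zero_or_eq_succ (g η) with h | ⟨i, h⟩
    · simp [h]
    · rw [this, h]
      simp

/-- Each selected element may depend on those selected before it; substituting these from the
outside in leaves functions of the outer assignment alone. -/
theorem exists_choice_of_selectBlock {n : ℕ} (p : ℕ) (C : CEE L (n + p))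
    (ζ : Selection M (CEE.selectBlock p C)) :
    ∃ (ζ' : Selection M C) (g : (Fin n → M) → Fin p → M), ∀ A B η,
      effect A B (CEE.selectBlock p C) ζ η = effect A B C ζ' (Fin.append η (g η)) := by
  induction p with
  | zero => exact ⟨ζ, fun _ => Fin.elim0, fun A B η => by rw [Fin.append_elim0]; rfl⟩
  | succ p ih =>
    obtain ⟨ζ', g, h⟩ := ih (.select ⊤ C) ζ
    refine ⟨ζ'.2, fun η => Fin.snoc (g η) (ζ'.1 (Fin.append η (g η))), fun A B η => ?_⟩
    refine (h A B η).trans ?_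
    rw [Fin.append_snoc]
    exact Set.ext fun δ => and_iff_right (holds_top A B _)

theorem exists_selection_selectBlock {n : ℕ} (p : ℕ) (C : CEE L (n + p))
    (ζ' : Selection M C) (g : (Fin n → M) → Fin p → M) :
    ∃ ζ : Selection M (CEE.selectBlock p C), ∀ A B η,
      effect A B (CEE.selectBlock p C) ζ η = effect A B C ζ' (Fin.append η (g η)) := by
  induction p with
  | zero =>
    refine ⟨ζ', fun A B η => ?_⟩
    rw [Subsingleton.elim (g η) Fin.elim0, Fin.append_elim0]
    rfl
  | succ p ih =>
    -- The innermost selection also sees the `p` elements selected before; it ignores them and reads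
    -- only the first `n` variables.
    obtain ⟨ζ, h⟩ := ih (.select ⊤ C) (fun η => g (fun i => η (Fin.castAdd p i)) (Fin.last p), ζ')
      fun η => Fin.init (g η)
    refine ⟨ζ, fun A B η => ?_⟩
    have e : Fin.append η (g η) =
        Fin.snoc (Fin.append η (Fin.init (g η))) (g η (Fin.last p)) := by
      rw [← Fin.append_snoc, Fin.snoc_init_self]
    refine (h A B η).trans ?_
    rw [e]
    refine Set.ext fun δ => (and_iff_right (holds_top A B _)).trans ?_
    simp only [Fin.append_left]

theorem exists_effect_allTrue_eq (n : ℕ) (C : CEE L n) (ζ : Selection M (CEE.allTrue n C)) :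
    ∃ ζ' : Selection M C, ∀ A B,
      effect A B (CEE.allTrue n C) ζ default = {δ | ∃ η, δ ∈ effect A B C ζ' η} := by
  induction n with
  | zero =>
    exact ⟨ζ, fun A B => by simp [Unique.exists_iff]; rfl⟩
  | succ n ih =>
    obtain ⟨ζ', h⟩ := ih (.all ⊤ C) ζ
    refine ⟨ζ', fun A B => ?_⟩
    refine (h A B).trans ?_
    ext δ
    simp only [effect, mem_ofPred_eq]
    constructor
    · rintro ⟨η, d, -, h⟩
      exact ⟨_, h⟩
    · rintro ⟨η, h⟩
      exact ⟨Fin.init η, η (Fin.last n), holds_top _ _ _, by rwa [Fin.snoc_init_self]⟩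

theorem exists_selection_allTrue (n : ℕ) (C : CEE L n) (ζ' : Selection M C) :
    ∃ ζ : Selection M (CEE.allTrue n C), ∀ A B,
      effect A B (CEE.allTrue n C) ζ default = {δ | ∃ η, δ ∈ effect A B C ζ' η} := by
  induction n with
  | zero =>
    exact ⟨ζ', fun A B => by simp [Unique.exists_iff]; rfl⟩
  | succ n ih =>
    obtain ⟨ζ, h⟩ := ih (.all ⊤ C) ζ'
    refine ⟨ζ, fun A B => ?_⟩
    refine (h A B).trans ?_
    ext δ
    simp only [effect, mem_ofPred_eq]
    constructor
    · rintro ⟨η, d, -, h⟩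
      exact ⟨_, h⟩
    · rintro ⟨η, h⟩
      exact ⟨Fin.init η, η (Fin.last n), holds_top _ _ _, by rwa [Fin.snoc_init_self]⟩

theorem exists_effect_allBlock_eq (n : ℕ) (φ : L.BoundedFormula Empty n) (C : CEE L n)
    (ζ : Selection M (CEE.allBlock n φ C)) :
    ∃ ζ' : Selection M C, ∀ A B, effect A B (CEE.allBlock n φ C) ζ default =
      {δ | ∃ η, Holds A B φ η ∧ δ ∈ effect A B C ζ' η} := by
  cases n with
  | zero =>
    exact ⟨ζ, fun A B => by simp [Unique.exists_iff]; rfl⟩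
  | succ n =>
    obtain ⟨ζ', h⟩ := exists_effect_allTrue_eq n (.all φ C) ζ
    refine ⟨ζ', fun A B => (h A B).trans (Set.ext fun δ => ⟨?_, ?_⟩)⟩
    · rintro ⟨η, d, h⟩
      exact ⟨_, h⟩
    · rintro ⟨η, h⟩
      exact ⟨Fin.init η, η (Fin.last n), by rwa [Fin.snoc_init_self]⟩

theorem exists_selection_allBlock (n : ℕ) (φ : L.BoundedFormula Empty n) (C : CEE L n)
    (ζ' : Selection M C) :
    ∃ ζ : Selection M (CEE.allBlock n φ C), ∀ A B, effect A B (CEE.allBlock n φ C) ζ default =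
      {δ | ∃ η, Holds A B φ η ∧ δ ∈ effect A B C ζ' η} := by
  cases n with
  | zero =>
    exact ⟨ζ', fun A B => by simp [Unique.exists_iff]; rfl⟩
  | succ n =>
    obtain ⟨ζ, h⟩ := exists_selection_allTrue n (.all φ C) ζ'
    refine ⟨ζ, fun A B => (h A B).trans (Set.ext fun δ => ⟨?_, ?_⟩)⟩
    · rintro ⟨η, d, h⟩
      exact ⟨_, h⟩
    · rintro ⟨η, h⟩
      exact ⟨Fin.init η, η (Fin.last n), by rwa [Fin.snoc_init_self]⟩

/-! ### Choices of heads -/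

variable (M) in
/-- For every instance of a rule with nonempty head: an atom of the head, and values for the
existentially quantified variables. -/
def Rule.Choice (r : Rule L) : Type w :=
  r.head ≠ [] → (Fin r.numX → M) → Fin r.head.length × (Fin r.numY → M)

/-- The domain atom chosen for an instance of a rule. -/
def Rule.chosen (r : Rule L) (s : r.Choice M) (h : r.head ≠ []) (η : Fin r.numX → M) :
    DomainAtom L M :=
  (r.head.get (s h η).1).inst (Fin.append η (s h η).2)

/-- The chosen atoms of the instances of a rule with certainly true body. -/
def Rule.chosenEffect (r : Rule L) (s : r.Choice M) (A B : Set (DomainAtom L M)) :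
    Set (DomainAtom L M) :=
  {δ | ∃ (h : r.head ≠ []) (η : Fin r.numX → M),
    Holds A B r.bodyFormula η ∧ r.chosen s h η = δ}

/-- The chosen atoms of the instances of the rules of a list with certainly true body. -/
def chosenEffect (rs : List (Rule L)) (s : (r : Rule L) → r.Choice M)
    (A B : Set (DomainAtom L M)) : Set (DomainAtom L M) :=
  {δ | ∃ r ∈ rs, δ ∈ r.chosenEffect (s r) A B}

instance [Nonempty M] (r : Rule L) : Nonempty (r.Choice M) :=
  ⟨fun h _ => (⟨0, List.length_pos_of_ne_nil h⟩, fun _ => Classical.arbitrary M)⟩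

theorem chosenEffect_cons (r : Rule L) (rs : List (Rule L)) (s : (r : Rule L) → r.Choice M)
    (A B : Set (DomainAtom L M)) :
    chosenEffect (r :: rs) s A B = r.chosenEffect (s r) A B ∪ chosenEffect rs s A B :=
  Set.ext fun δ => by simp [chosenEffect]

theorem Rule.toCEE_eq_none_iff (r : Rule L) : r.toCEE = none ↔ r.head = [] := by
  obtain ⟨nx, ny, head, pos, neg⟩ := r
  cases head <;> simp [Rule.toCEE]

theorem Rule.chosenEffect_of_toCEE_eq_none {r : Rule L} (h : r.toCEE = none) (s : r.Choice M)
    (A B : Set (DomainAtom L M)) : r.chosenEffect s A B = ∅ :=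
  eq_empty_of_forall_notMem fun _ ⟨h', _⟩ => h' ((r.toCEE_eq_none_iff).1 h)

theorem chosenEffect_of_filterMap_eq_nil {rs : List (Rule L)}
    (h : rs.filterMap Rule.toCEE = []) (s : (r : Rule L) → r.Choice M)
    (A B : Set (DomainAtom L M)) : chosenEffect rs s A B = ∅ :=
  eq_empty_of_forall_notMem fun _ ⟨r, hr, hδ⟩ => by
    rw [Rule.chosenEffect_of_toCEE_eq_none (List.filterMap_eq_nil_iff.1 h r hr)] at hδ
    exact hδ

theorem Rule.exists_choice_of_selection {r : Rule L} {C : CEE L 0} (h : r.toCEE = some C)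
    (ζ : Selection M C) :
    ∃ s : r.Choice M, ∀ A B, effect A B C ζ default = r.chosenEffect s A B := by
  obtain ⟨nx, ny, _ | ⟨a, l⟩, pos, neg⟩ := r
  · simp [Rule.toCEE] at h
  obtain rfl := Option.some.inj h
  obtain ⟨ζ₁, h₁⟩ := exists_effect_allBlock_eq _ _ _ ζ
  obtain ⟨ζ₂, g, h₂⟩ := exists_choice_of_selectBlock _ _ ζ₁
  obtain ⟨i, h₃⟩ := exists_choice_of_orList _ _ ζ₂
  refine ⟨fun _ η => (i (Fin.append η (g η)), g η), fun A B => (h₁ A B).trans ?_⟩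
  ext δ
  simp only [h₂, h₃, mem_singleton_iff, Rule.chosenEffect, Rule.chosen, mem_ofPred_eq,
    eq_comm (a := δ)]
  exact ⟨fun h => ⟨List.cons_ne_nil _ _, h⟩, fun ⟨_, h⟩ => h⟩

theorem Rule.exists_selection_of_choice {r : Rule L} {C : CEE L 0} (h : r.toCEE = some C)
    (s : r.Choice M) :
    ∃ ζ : Selection M C, ∀ A B, effect A B C ζ default = r.chosenEffect s A B := by
  obtain ⟨nx, ny, _ | ⟨a, l⟩, pos, neg⟩ := r
  · simp [Rule.toCEE] at h
  obtain rfl := Option.some.inj h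
  have hne : a :: l ≠ [] := List.cons_ne_nil _ _
  -- The disjunction is evaluated at an assignment of all variables, but the choice of head atom
  -- depends only on the universal ones.
  obtain ⟨ζ₂, h₃⟩ := exists_selection_orList a l
    fun η => (s hne fun j => η (Fin.castAdd ny j)).1
  obtain ⟨ζ₁, h₂⟩ := exists_selection_selectBlock _ _ ζ₂ fun η => (s hne η).2
  obtain ⟨ζ, h₁⟩ := exists_selection_allBlock _
    (Rule.bodyFormula ⟨nx, ny, a :: l, pos, neg⟩) _ ζ₁
  refine ⟨ζ, fun A B => (h₁ A B).trans ?_⟩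
  ext δ
  simp only [h₂, h₃, mem_singleton_iff, Rule.chosenEffect, Rule.chosen, mem_ofPred_eq,
    eq_comm (a := δ), Fin.append_left]
  exact ⟨fun h => ⟨hne, h⟩, fun ⟨_, h⟩ => h⟩

/-- A choice is indexed by rules and a selection by occurrences, so a rule listed twice could be
given two conflicting choices; `Nodup` excludes this. -/
theorem exists_choice_of_selection [Nonempty M] {rs : List (Rule L)} (hrs : rs.Nodup)
    {C : CEE L 0} {l : List (CEE L 0)} (h : rs.filterMap Rule.toCEE = C :: l)
    (ζ : Selection M (CEE.andList C l)) :
    ∃ s : (r : Rule L) → r.Choice M, ∀ A B,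
      effect A B (CEE.andList C l) ζ default = chosenEffect rs s A B := by
  classical
  induction rs generalizing C l with
  | nil => simp at h
  | cons r rs ih =>
    obtain ⟨hr, hrs⟩ := List.nodup_cons.1 hrs
    -- Overwriting the choice at `r` leaves the tail untouched because `r` does not occur in it.
    have key (s : (r : Rule L) → r.Choice M) (s₀ : r.Choice M) (A B : Set (DomainAtom L M)) :
        chosenEffect (r :: rs) (Function.update s r s₀) A B =
          r.chosenEffect s₀ A B ∪ chosenEffect rs s A B := by
      rw [chosenEffect_cons, Function.update_self]
      congr 1
      refine Set.ext fun δ => exists_congr fun r' => and_congr_right fun hr' => ?_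
      rw [Function.update_of_ne (ne_of_mem_of_not_mem hr' hr)]
    rcases hD : r.toCEE with _ | D
    · rw [List.filterMap_cons_none hD] at h
      obtain ⟨s, hs⟩ := ih hrs h ζ
      refine ⟨s, fun A B => ?_⟩
      rw [hs, chosenEffect_cons, Rule.chosenEffect_of_toCEE_eq_none hD, empty_union]
    · rw [List.filterMap_cons_some hD] at h
      obtain ⟨rfl, hl⟩ := List.cons.inj h
      rcases l with _ | ⟨E, l⟩
      · obtain ⟨s₀, hs₀⟩ := Rule.exists_choice_of_selection hD ζ
        refine ⟨Function.update (fun _ => Classical.arbitrary _) r s₀, fun A B => ?_⟩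
        rw [key, chosenEffect_of_filterMap_eq_nil hl, union_empty]
        exact hs₀ A B
      · obtain ⟨s₀, hs₀⟩ := Rule.exists_choice_of_selection hD ζ.1
        obtain ⟨s, hs⟩ := ih hrs hl ζ.2
        refine ⟨Function.update s r s₀, fun A B => ?_⟩
        rw [key, ← hs₀, ← hs]
        rfl

theorem exists_selection_of_choice {rs : List (Rule L)}
    {C : CEE L 0} {l : List (CEE L 0)} (h : rs.filterMap Rule.toCEE = C :: l)
    (s : (r : Rule L) → r.Choice M) :
    ∃ ζ : Selection M (CEE.andList C l), ∀ A B,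
      effect A B (CEE.andList C l) ζ default = chosenEffect rs s A B := by
  induction rs generalizing C l with
  | nil => simp at h
  | cons r rs ih =>
    rcases hD : r.toCEE with _ | D
    · rw [List.filterMap_cons_none hD] at h
      obtain ⟨ζ, hs⟩ := ih h
      refine ⟨ζ, fun A B => ?_⟩
      rw [hs, chosenEffect_cons, Rule.chosenEffect_of_toCEE_eq_none hD, empty_union]
    · rw [List.filterMap_cons_some hD] at h
      obtain ⟨rfl, rfl⟩ := List.cons.inj h
      obtain ⟨ζ₀, hζ₀⟩ := Rule.exists_selection_of_choice hD (s r)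
      rcases hl : rs.filterMap Rule.toCEE with _ | ⟨E, l⟩
      · refine ⟨ζ₀, fun A B => ?_⟩
        rw [chosenEffect_cons, chosenEffect_of_filterMap_eq_nil hl, union_empty]
        exact hζ₀ A B
      · obtain ⟨ζ, hζ⟩ := ih hl
        refine ⟨(ζ₀, ζ), fun A B => ?_⟩
        rw [chosenEffect_cons, ← hζ₀, ← hζ]
        rfl

/-! ### Every selection is proper for a translated program -/

theorem selectsProperly_orList {n : ℕ} (a : Atom L n) (l : List (Atom L n))
    (ζ : Selection M (CEE.orList a l)) (η : Fin n → M) :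
    SelectsProperly (CEE.orList a l) ζ η := by
  induction l generalizing a with
  | nil => trivial
  | cons b l ih =>
    simp only [CEE.orList, SelectsProperly]
    cases ζ.1 η
    · exact ih b _
    · trivial

theorem selectsProperly_selectBlock {n : ℕ} (p : ℕ) (C : CEE L (n + p))
    (hC : ∀ (ζ : Selection M C) η, SelectsProperly C ζ η)
    (ζ : Selection M (CEE.selectBlock p C)) (η : Fin n → M) :
    SelectsProperly (CEE.selectBlock p C) ζ η := by
  induction p with
  | zero => exact hC ζ η
  | succ p ih => exact ih (.select ⊤ C) (fun ζ η => ⟨fun h => h, hC _ _⟩) ζ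

theorem selectsProperly_allTrue (n : ℕ) (C : CEE L n)
    (hC : ∀ (ζ : Selection M C) η, SelectsProperly C ζ η)
    (ζ : Selection M (CEE.allTrue n C)) (η : Fin 0 → M) :
    SelectsProperly (CEE.allTrue n C) ζ η := by
  induction n with
  | zero => exact hC ζ η
  | succ n ih => exact ih (.all ⊤ C) (fun ζ η d _ => hC _ _) ζ

theorem Rule.selectsProperly {r : Rule L} {C : CEE L 0} (h : r.toCEE = some C)
    (ζ : Selection M C) (η : Fin 0 → M) : SelectsProperly C ζ η := by
  obtain ⟨nx, ny, _ | ⟨a, l⟩, pos, neg⟩ := r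
  · simp [Rule.toCEE] at h
  obtain rfl := Option.some.inj h
  have key := selectsProperly_selectBlock (M := M) (n := nx) ny _ (selectsProperly_orList a l)
  cases nx with
  | zero => exact fun _ => key ζ η
  | succ n =>
    exact selectsProperly_allTrue n
      (.all (Rule.bodyFormula ⟨n + 1, ny, a :: l, pos, neg⟩) (CEE.selectBlock ny (CEE.orList a l)))
      (fun ζ η d _ => key ζ _) ζ η

theorem selectsProperly_andList {C : CEE L 0} {l : List (CEE L 0)}
    (h : ∀ D ∈ C :: l, ∀ (ζ : Selection M D) η, SelectsProperly D ζ η)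
    (ζ : Selection M (CEE.andList C l)) (η : Fin 0 → M) :
    SelectsProperly (CEE.andList C l) ζ η := by
  induction l generalizing C with
  | nil => exact h C (by simp) ζ η
  | cons D l ih =>
    exact ⟨h C (by simp) ζ.1 η, ih (fun E hE => h E (List.mem_cons_of_mem _ hE)) ζ.2⟩

end Structure

/-! ### Endogenous predicates of the translation -/

section Endogenous

variable {L : FirstOrder.Language.{u, v}} {k : ℕ} (R : L.Relations k)

theorem CEE.endogenous_orList {n : ℕ} (a : Atom L n) (l : List (Atom L n)) :
    (CEE.orList a l).Endogenous R ↔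
      ∃ b ∈ a :: l, (⟨k, R⟩ : (k : ℕ) × L.Relations k) = ⟨b.arity, b.rel⟩ := by
  induction l generalizing a with
  | nil => simp [CEE.orList, CEE.Endogenous]
  | cons b l ih => rw [CEE.orList, CEE.Endogenous, ih, List.exists_mem_cons_iff _ a]; rfl

theorem CEE.endogenous_selectBlock {n : ℕ} (p : ℕ) (C : CEE L (n + p)) :
    (CEE.selectBlock p C).Endogenous R ↔ C.Endogenous R := by
  induction p with
  | zero => rfl
  | succ p ih => exact ih (.select ⊤ C)

theorem CEE.endogenous_allTrue (n : ℕ) (C : CEE L n) :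
    (CEE.allTrue n C).Endogenous R ↔ C.Endogenous R := by
  induction n with
  | zero => rfl
  | succ n ih => exact ih (.all ⊤ C)

theorem CEE.endogenous_allBlock (n : ℕ) (φ : L.BoundedFormula Empty n) (C : CEE L n) :
    (CEE.allBlock n φ C).Endogenous R ↔ C.Endogenous R := by
  cases n with
  | zero => rfl
  | succ n => exact CEE.endogenous_allTrue R n (.all φ C)

theorem CEE.endogenous_andList {n : ℕ} (C : CEE L n) (l : List (CEE L n)) :
    (CEE.andList C l).Endogenous R ↔ ∃ D ∈ C :: l, D.Endogenous R := by
  induction l generalizing C with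
  | nil => simp [CEE.andList]
  | cons D l ih => rw [CEE.andList, CEE.Endogenous, ih, List.exists_mem_cons_iff _ C]

theorem Rule.endogenous_toCEE {r : Rule L} {C : CEE L 0} (h : r.toCEE = some C) :
    C.Endogenous R ↔
      ∃ a ∈ r.head, (⟨k, R⟩ : (k : ℕ) × L.Relations k) = ⟨a.arity, a.rel⟩ := by
  obtain ⟨nx, ny, _ | ⟨a, l⟩, pos, neg⟩ := r
  · simp [Rule.toCEE] at h
  obtain rfl := Option.some.inj h
  rw [CEE.endogenous_allBlock, CEE.endogenous_selectBlock, CEE.endogenous_orList]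

/-- This matches the exogenous predicates with those that the sentences of the translation make
false, so that in a model `cause` has no exogenous part. -/
theorem Program.endogenous_iff_inHead {P : Program L} {C : CEE L 0} {l : List (CEE L 0)}
    (h : P.toList.filterMap Rule.toCEE = C :: l) :
    (CEE.andList C l).Endogenous R ↔ P.InHead R := by
  rw [CEE.endogenous_andList, ← h, Program.InHead]
  simp only [List.mem_filterMap, Finset.mem_toList]
  constructor
  · rintro ⟨D, ⟨r, hr, hD⟩, hR⟩
    exact ⟨r, hr, (Rule.endogenous_toCEE R hD).1 hR⟩
  · rintro ⟨r, hr, hR⟩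
    rcases hD : r.toCEE with _ | D
    · rw [(r.toCEE_eq_none_iff).1 hD] at hR
      simp at hR
    · exact ⟨D, ⟨r, hr, hD⟩, (Rule.endogenous_toCEE R hD).2 hR⟩

end Endogenous

/-! ### Stratification -/

section Stratification

variable {L : FirstOrder.Language.{u, v}} {M : Type w}

/-- The image of a domain atom under a map of the domain. -/
def DomainAtom.map (f : M → M) (δ : DomainAtom L M) : DomainAtom L M :=
  ⟨δ.arity, δ.rel, f ∘ δ.args⟩

variable [L.Structure M]

/-- The elements denoted by the arguments of an atom when all variables have the value `d`. -/
def Atom.values {n : ℕ} (a : Atom L n) (d : M) : Set M :=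
  Set.range (a.inst fun _ => d).args

/-- The value `d` and the interpretations of the constants that occur in the program. -/
def Program.values (P : Program L) (d : M) : Set M :=
  {d} ∪ ⋃ r ∈ P, (⋃ a ∈ r.head, a.values d) ∪ (⋃ b ∈ r.pos, b.values d) ∪
    ⋃ c ∈ r.neg, c.values d

theorem Program.finite_values (P : Program L) (d : M) : (P.values d).Finite := by
  have key {n : ℕ} (l : List (Atom L n)) : (⋃ a ∈ l, a.values d).Finite :=
    l.finite_toSet.biUnion fun a _ => Set.finite_range _
  exact (Set.finite_singleton d).union
    (P.finite_toSet.biUnion fun r _ => ((key _).union (key _)).union (key _))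

open Classical in
/-- The map that collapses all elements outside of `D` to `d`. -/
noncomputable def collapse (D : Set M) (d x : M) : M :=
  if x ∈ D then x else d

theorem collapse_mem {D : Set M} {d : M} (hd : d ∈ D) (x : M) : collapse D d x ∈ D := by
  unfold collapse
  split_ifs with h
  exacts [h, hd]

/-- Without proper function symbols every argument is a variable or a constant. Variables commute
with the collapse, and a constant denotes an element of `a.values d`, which the collapse fixes. -/
theorem Atom.map_collapse_inst (hL : ∀ n : ℕ, IsEmpty (L.Functions (n + 1))) {n : ℕ}
    (a : Atom L n) {D : Set M} {d : M} (ha : a.values d ⊆ D) (η : Fin n → M) :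
    (a.inst η).map (collapse D d) = a.inst (collapse D d ∘ η) := by
  refine congrArg (DomainAtom.mk a.arity a.rel) (funext fun i => ?_)
  have hi := ha ⟨i, rfl⟩
  change (a.args i).realize (Sum.elim (default : Empty → M) fun _ => d) ∈ D at hi
  change collapse D d ((a.args i).realize (Sum.elim default η)) =
    (a.args i).realize (Sum.elim default (collapse D d ∘ η))
  generalize a.args i = t at hi ⊢
  cases t with
  | var x =>
    rcases x with x | x
    · exact x.elim
    · rfl
  | @func k c ts =>
    cases k with
    | zero =>
      have e (ρ : Empty ⊕ Fin n → M) : (FirstOrder.Language.Term.func c ts).realize ρ =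
          FirstOrder.Language.Structure.funMap c default :=
        congrArg (FirstOrder.Language.Structure.funMap c) (Subsingleton.elim _ _)
      rw [e] at hi
      rw [e, e, collapse, if_pos hi]
    | succ k => exact (hL k).elim c

theorem comp_append {m n : ℕ} (f : M → M) (η : Fin m → M) (θ : Fin n → M) :
    f ∘ Fin.append η θ = Fin.append (f ∘ η) (f ∘ θ) := by
  funext i
  refine Fin.addCases (fun i => ?_) (fun i => ?_) i <;> simp

theorem Program.values_head_subset (P : Program L) (d : M) {r : Rule L} (hr : r ∈ P) {a : Atom L (r.numX + r.numY)}
    (ha : a ∈ r.head) : a.values d ⊆ P.values d := fun _ hx =>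
  Or.inr (Set.mem_biUnion hr (Or.inl (Or.inl (Set.mem_biUnion (s := {a | a ∈ r.head}) ha hx))))

theorem Program.values_pos_subset (P : Program L) (d : M) {r : Rule L} (hr : r ∈ P) {a : Atom L r.numX}
    (ha : a ∈ r.pos) : a.values d ⊆ P.values d := fun _ hx =>
  Or.inr (Set.mem_biUnion hr (Or.inl (Or.inr (Set.mem_biUnion (s := {a | a ∈ r.pos}) ha hx))))

theorem Program.values_neg_subset (P : Program L) (d : M) {r : Rule L} (hr : r ∈ P) {a : Atom L r.numX}
    (ha : a ∈ r.neg) : a.values d ⊆ P.values d := fun _ hx =>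
  Or.inr (Set.mem_biUnion hr (Or.inr (Set.mem_biUnion (s := {a | a ∈ r.neg}) ha hx)))

/-- Collapsing the assignment of a rule instance gives another instance of the same rule, so edges
go to edges. -/
theorem Program.PosDepends.map_collapse (hL : ∀ n : ℕ, IsEmpty (L.Functions (n + 1)))
    {P : Program L} (d : M) {δ ε : DomainAtom L M} (h : P.PosDepends δ ε) :
    P.PosDepends (δ.map (collapse (P.values d) d)) (ε.map (collapse (P.values d) d)) := by
  obtain ⟨r, hr, η, θ, ⟨a, ha, rfl⟩, b, hb, rfl⟩ := h
  refine ⟨r, hr, _, collapse (P.values d) d ∘ θ, ⟨a, ha, ?_⟩, b, hb,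
    (b.map_collapse_inst hL (P.values_pos_subset d hr hb) η).symm⟩
  rw [a.map_collapse_inst hL (P.values_head_subset d hr ha), comp_append]

theorem Program.NegDepends.map_collapse (hL : ∀ n : ℕ, IsEmpty (L.Functions (n + 1)))
    {P : Program L} (d : M) {δ ε : DomainAtom L M} (h : P.NegDepends δ ε) :
    P.NegDepends (δ.map (collapse (P.values d) d)) (ε.map (collapse (P.values d) d)) := by
  obtain ⟨r, hr, η, θ, ⟨a, ha, rfl⟩, b, hb, rfl⟩ := h
  refine ⟨r, hr, _, collapse (P.values d) d ∘ θ, ⟨a, ha, ?_⟩, b, hb,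
    (b.map_collapse_inst hL (P.values_neg_subset d hr hb) η).symm⟩
  rw [a.map_collapse_inst hL (P.values_head_subset d hr ha), comp_append]

/-- `δ` depends on `ε` through a negative edge of the dependency graph. -/
def Program.DependsThroughNeg (P : Program L) (δ ε : DomainAtom L M) : Prop :=
  ∃ α β, Relation.ReflTransGen (fun δ ε => P.PosDepends δ ε ∨ P.NegDepends δ ε) δ α ∧
    P.NegDepends α β ∧ Relation.ReflTransGen (fun δ ε => P.PosDepends δ ε ∨ P.NegDepends δ ε) β ε

theorem Program.DependsThroughNeg.of_depends {P : Program L} {δ ε γ : DomainAtom L M}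
    (h : P.PosDepends δ ε ∨ P.NegDepends δ ε) : P.DependsThroughNeg ε γ →
      P.DependsThroughNeg δ γ :=
  fun ⟨α, β, h₁, h₂, h₃⟩ => ⟨α, β, h₁.head h, h₂, h₃⟩

theorem Program.NoRecursionOverNegation.not_dependsThroughNeg {P : Program L}
    (h : P.NoRecursionOverNegation M) (δ : DomainAtom L M) : ¬ P.DependsThroughNeg δ δ :=
  fun ⟨α, β, h₁, h₂, h₃⟩ => h α β h₂ (h₃.trans h₁)

/-- The instances of the negated body atoms with arguments in `P.values d`. -/
def Program.negInstances (P : Program L) (d : M) : Set (DomainAtom L M) :=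
  ⋃ r ∈ P, ⋃ c ∈ r.neg, c.inst '' {η | ∀ i, η i ∈ P.values d}

theorem Program.finite_negInstances (P : Program L) (d : M) : (P.negInstances d).Finite :=
  P.finite_toSet.biUnion fun r _ => r.neg.finite_toSet.biUnion fun _ _ =>
    (Set.Finite.pi' fun _ => P.finite_values d).image _

theorem Program.NegDepends.mem_negInstances (hL : ∀ n : ℕ, IsEmpty (L.Functions (n + 1)))
    {P : Program L} (d : M) {δ ε : DomainAtom L M} (h : P.NegDepends δ ε) :
    ε.map (collapse (P.values d) d) ∈ P.negInstances d := by
  obtain ⟨r, hr, η, -, -, c, hc, rfl⟩ := h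
  rw [c.map_collapse_inst hL (P.values_neg_subset d hr hc)]
  exact Set.mem_biUnion hr (Set.mem_biUnion (s := {a | a ∈ r.neg}) hc
    ⟨_, fun i => collapse_mem (D := P.values d) (Or.inl rfl) _, rfl⟩)

/-- Over a relational vocabulary, a program without recursion over negation is stratified, with
finite ranks: collapsing the elements that are not denoted by constants maps the dependency graph
into a finite part of itself. -/
theorem Program.NoRecursionOverNegation.exists_rank [Nonempty M]
    (hL : ∀ n : ℕ, IsEmpty (L.Functions (n + 1))) {P : Program L}
    (h : P.NoRecursionOverNegation M) :
    ∃ rank : DomainAtom L M → ℕ, (∀ δ ε, P.PosDepends δ ε → rank ε ≤ rank δ) ∧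
      ∀ δ ε, P.NegDepends δ ε → rank ε < rank δ := by
  obtain ⟨d⟩ := ‹Nonempty M›
  have hfin (δ : DomainAtom L M) : {ε ∈ P.negInstances d | P.DependsThroughNeg δ ε}.Finite :=
    (P.finite_negInstances d).subset fun _ h => h.1
  -- The rank counts the collapsed targets of negative edges that are reachable from the collapsed
  -- atom through a negative edge. An edge can only shrink this finite set.
  refine ⟨fun δ => {ε ∈ P.negInstances d |
    P.DependsThroughNeg (δ.map (collapse (P.values d) d)) ε}.ncard, ?_, ?_⟩
  · intro δ ε hδ
    exact Set.ncard_le_ncard (fun γ hγ => ⟨hγ.1, hγ.2.of_depends (.inl (hδ.map_collapse hL d))⟩)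
      (hfin _)
  · intro δ ε hδ
    have hδ' := hδ.map_collapse hL d
    refine Set.ncard_lt_ncard ⟨fun γ hγ => ⟨hγ.1, hγ.2.of_depends (.inr hδ')⟩, fun hs => ?_⟩
      (hfin _)
    -- The collapsed `ε` is counted for `δ`; if it were counted for `ε` as well, it would lie on a
    -- cycle through a negative edge.
    exact h.not_dependsThroughNeg _ (hs ⟨hδ.mem_negInstances hL d, _, _, .refl, hδ', .refl⟩).2

end Stratification

/-! ### Fixpoints -/

section Fixpoints

variable {L : FirstOrder.Language.{u, v}} {M : Type w} [L.Structure M]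

theorem cause_stableOp (C : CEE L 0) (ζ : Selection M C) (B : Set (DomainAtom L M)) :
    cause C ζ (stableOp C ζ B) B = stableOp C ζ B :=
  OrderHom.map_lfp ⟨fun A => cause C ζ A B, fun _ _ h => cause_mono C ζ h le_rfl⟩

theorem stableOp_subset {C : CEE L 0} {ζ : Selection M C} {B X : Set (DomainAtom L M)}
    (h : cause C ζ X B ⊆ X) : stableOp C ζ B ⊆ X :=
  OrderHom.lfp_le ⟨fun A => cause C ζ A B, fun _ _ h => cause_mono C ζ h le_rfl⟩ h

theorem stableOp_wellFoundedFixpoint (C : CEE L 0) (ζ : Selection M C) :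
    stableOp C ζ (OrderDual.ofDual (wellFoundedFixpoint C ζ).2) = (wellFoundedFixpoint C ζ).1 ∧
    stableOp C ζ (wellFoundedFixpoint C ζ).1 =
      OrderDual.ofDual (wellFoundedFixpoint C ζ).2 := by
  have h : (_, _) = wellFoundedFixpoint C ζ := OrderHom.map_lfp
    ⟨fun p => (stableOp C ζ (OrderDual.ofDual p.2), OrderDual.toDual (stableOp C ζ p.1)),
      fun _ _ h => Prod.mk_le_mk.2 ⟨stableOp_anti C ζ h.2, stableOp_anti C ζ h.1⟩⟩
  exact ⟨congrArg Prod.fst h, congrArg Prod.snd h⟩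

theorem wellFoundedFixpoint_le {C : CEE L 0} {ζ : Selection M C} {T : Set (DomainAtom L M)}
    (h : stableOp C ζ T = T) : wellFoundedFixpoint C ζ ≤ (T, OrderDual.toDual T) :=
  OrderHom.lfp_le_fixed
    ⟨fun p => (stableOp C ζ (OrderDual.ofDual p.2), OrderDual.toDual (stableOp C ζ p.1)),
      fun _ _ h => Prod.mk_le_mk.2 ⟨stableOp_anti C ζ h.2, stableOp_anti C ζ h.1⟩⟩
    (Prod.ext h (congrArg OrderDual.toDual h))

/-- A fixpoint of the stable operator is the well-founded fixpoint, when each atom in the effect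
set has an explanation by atoms of at most the same rank, in which the negated atoms have a
smaller rank. -/
theorem wellFoundedFixpoint_eq {C : CEE L 0} {ζ : Selection M C} {T : Set (DomainAtom L M)}
    (h : stableOp C ζ T = T) (rank : DomainAtom L M → ℕ)
    (hrank : ∀ A B δ, δ ∈ effect A B C ζ default → ∃ pos neg : Set (DomainAtom L M),
      pos ⊆ A ∧ Disjoint neg B ∧ (∀ ε ∈ pos, rank ε ≤ rank δ) ∧ (∀ ε ∈ neg, rank ε < rank δ) ∧
        ∀ A' B', pos ⊆ A' → Disjoint neg B' → δ ∈ effect A' B' C ζ default) :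
    wellFoundedFixpoint C ζ = (T, OrderDual.toDual T) := by
  obtain ⟨h₁, h₂⟩ := stableOp_wellFoundedFixpoint C ζ
  obtain ⟨h₃, h₄⟩ := Prod.le_def.1 (wellFoundedFixpoint_le h)
  generalize hW : wellFoundedFixpoint C ζ = W at *
  obtain ⟨A, B⟩ := W
  obtain ⟨B, rfl⟩ := OrderDual.toDual.surjective B
  simp only [OrderDual.ofDual_toDual] at h₁ h₂ h₃ h₄
  have h₄ : T ⊆ B := h₄
  -- The well-founded fixpoint is the least precise one, so `A ⊆ T ⊆ B`; it remains to close the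
  -- gap.
  suffices hBA : B ⊆ A by
    rw [h₃.antisymm (h₄.trans hBA), (hBA.trans h₃).antisymm h₄]
  suffices H : ∀ n, ∀ δ ∈ B, rank δ = n → δ ∈ A from fun δ hδ => H _ δ hδ rfl
  intro n
  induction n using Nat.strong_induction_on with
  | _ n ih =>
    -- `B` is the least fixpoint of `cause C ζ · A`. Proving the bound for all ranks up to `n` at
    -- once lets positive dependencies stay within rank `n`.
    suffices hB : stableOp C ζ A ⊆ {δ | rank δ ≤ n → δ ∈ A} from
      fun δ hδ hn => hB (h₂.symm ▸ hδ) hn.le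
    refine stableOp_subset ?_
    rintro δ (hδ | hδ) hn
    · rw [← h₁, ← cause_stableOp]
      exact Or.inl hδ
    · obtain ⟨pos, neg, hp, hneg, hpr, hnr, hδ⟩ := hrank _ _ _ hδ
      rw [← h₁, ← cause_stableOp, h₁]
      refine Or.inr (hδ _ _ (fun ε hε => hp hε ((hpr ε hε).trans hn)) ?_)
      -- The negated atoms are outside `A`. Having smaller rank, they are outside `B` too by the
      -- induction hypothesis, so `δ` is caused in `(A, B)` and hence lies in `A`.
      refine Set.disjoint_left.2 fun ε hε hεB => Set.disjoint_left.1 hneg hε ?_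
      exact ih _ ((hnr ε hε).trans_le hn) ε hεB rfl

end Fixpoints

/-! ### Stable models and models of the translation -/

theorem Rule.eq_of_not_disjunctive {L : FirstOrder.Language.{u, v}} {M : Type w} {r : Rule L}
    (h : ¬ r.Disjunctive) (i j : Fin r.head.length) (θ θ' : Fin r.numY → M) : i = j ∧ θ = θ' := by
  simp only [Rule.Disjunctive, not_or, not_not, not_lt] at h
  refine ⟨Fin.ext ?_, funext fun k => ?_⟩
  · have := i.2
    have := j.2
    omega
  · exact (Fin.cast h.1 k).elim0

section Main

variable {L : FirstOrder.Language.{u, v}} {M : Type w} [L.Structure M]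

theorem Rule.realize_bodyFormula (r : Rule L) (η : Fin r.numX → M) :
    r.bodyFormula.Realize default η ↔
      Holds (trueAtoms L M) (trueAtoms L M) r.bodyFormula η :=
  (holds_trueAtoms_iff _ _).symm

theorem Program.realize_sentences_iff (P : Program L) :
    (∀ φ ∈ P.toTheory.sentences, φ.Realize M) ↔
      (∀ r ∈ P, r.head = [] → ∀ η : Fin r.numX → M,
        ¬ Holds (trueAtoms L M) (trueAtoms L M) r.bodyFormula η) ∧
      ∀ δ ∈ trueAtoms L M, P.InHead δ.rel := by
  simp only [toTheory, Set.mem_union, or_imp, forall_and]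
  refine and_congr ⟨fun H r hr h η => ?_, ?_⟩ ⟨fun H δ hδ => ?_, ?_⟩
  · have := H _ ⟨r, hr, h, rfl⟩
    rw [FirstOrder.Language.Sentence.Realize, FirstOrder.Language.BoundedFormula.realize_alls] at this
    rw [← r.realize_bodyFormula]
    exact FirstOrder.Language.BoundedFormula.realize_not.1 (this η)
  · rintro H φ ⟨r, hr, h, rfl⟩
    rw [FirstOrder.Language.Sentence.Realize, FirstOrder.Language.BoundedFormula.realize_alls]
    intro η
    rw [FirstOrder.Language.BoundedFormula.realize_not]
    exact fun h' => H r hr h η ((r.realize_bodyFormula η).1 h')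
  · by_contra hP
    have := H _ ⟨_, δ.rel, hP, rfl⟩
    rw [FirstOrder.Language.Sentence.Realize, FirstOrder.Language.BoundedFormula.realize_alls] at this
    refine FirstOrder.Language.BoundedFormula.realize_not.1 (this δ.args) ?_
    rw [FirstOrder.Language.BoundedFormula.realize_rel]
    exact hδ
  · rintro H φ ⟨k, R, hR, rfl⟩
    rw [FirstOrder.Language.Sentence.Realize, FirstOrder.Language.BoundedFormula.realize_alls]
    intro η
    rw [FirstOrder.Language.BoundedFormula.realize_not,
      FirstOrder.Language.BoundedFormula.realize_rel]
    exact fun h => hR (H ⟨k, R, η⟩ h)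

/-- Discarding the true atoms whose predicate is in no head leaves a closed set, so minimality
forbids such atoms. -/
theorem Program.IsStableModel.inHead {P : Program L} (h : P.IsStableModel M)
    {δ : DomainAtom L M} (hδ : δ ∈ trueAtoms L M) : P.InHead δ.rel := by
  have hs : {δ | δ ∈ trueAtoms L M ∧ P.InHead δ.rel} ⊆ trueAtoms L M := fun _ h => h.1
  refine (h.2 (y := {δ | δ ∈ trueAtoms L M ∧ P.InHead δ.rel}) ?_ hs hδ).2
  intro r hr η hb
  rw [r.bodyEntailed_iff hs] at hb
  obtain ⟨θ, a, ha, hT⟩ := h.1 r hr η ((r.bodyEntailed_iff le_rfl η).2 (hb.mono _ hs le_rfl))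
  exact ⟨θ, a, ha, hT, r, hr, a, ha, rfl⟩

theorem Program.IsStableModel.not_holds {P : Program L} (h : P.IsStableModel M) {r : Rule L}
    (hr : r ∈ P) (hh : r.head = []) (η : Fin r.numX → M) :
    ¬ Holds (trueAtoms L M) (trueAtoms L M) r.bodyFormula η := by
  intro hb
  obtain ⟨θ, a, ha, -⟩ := h.1 r hr η ((r.bodyEntailed_iff le_rfl η).2 hb)
  simp [hh] at ha

/-- In a stable model, one can choose a true head atom for each rule instance with true body. -/
theorem Program.IsStableModel.exists_choice [Nonempty M] {P : Program L}
    (h : P.IsStableModel M) :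
    ∃ s : (r : Rule L) → r.Choice M, chosenEffect P.toList s (trueAtoms L M) (trueAtoms L M) ⊆
      trueAtoms L M := by
  have key (r : Rule L) (hh : r.head ≠ []) (η : Fin r.numX → M) :
      -- The conditions stand under the existential so that the choice is total; it is arbitrary
      -- where they fail.
      ∃ c : Fin r.head.length × (Fin r.numY → M), r ∈ P →
        Holds (trueAtoms L M) (trueAtoms L M) r.bodyFormula η →
          (r.head.get c.1).inst (Fin.append η c.2) ∈ trueAtoms L M := by
    by_cases hc : r ∈ P ∧ Holds (trueAtoms L M) (trueAtoms L M) r.bodyFormula η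
    · obtain ⟨θ, a, ha, hT⟩ := h.1 r hc.1 η ((r.bodyEntailed_iff le_rfl η).2 hc.2)
      obtain ⟨i, rfl⟩ := List.mem_iff_get.1 ha
      exact ⟨(i, θ), fun _ _ => hT⟩
    · exact ⟨(⟨0, List.length_pos_of_ne_nil hh⟩, fun _ => Classical.arbitrary M),
        fun h₁ h₂ => (hc ⟨h₁, h₂⟩).elim⟩
  choose s hs using key
  refine ⟨s, ?_⟩
  rintro _ ⟨r, hr, hh, η, hb, rfl⟩
  exact hs r hh η (Finset.mem_toList.1 hr) hb

theorem Program.closed_of_chosenEffect_subset {P : Program L} {T X : Set (DomainAtom L M)}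
    {s : (r : Rule L) → r.Choice M} (hX : X ⊆ T) (h : chosenEffect P.toList s X T ⊆ X)
    (hT : ∀ r ∈ P, r.head = [] → ∀ η : Fin r.numX → M, ¬ Holds T T r.bodyFormula η) :
    P.Closed T X := by
  intro r hr η hb
  rw [r.bodyEntailed_iff hX] at hb
  have hh : r.head ≠ [] := fun hh => hT r hr hh η (hb.mono _ hX le_rfl)
  exact ⟨_, _, List.get_mem _ _, h ⟨r, Finset.mem_toList.2 hr, hh, η, hb, rfl⟩⟩

/-- The explanation is the body of the rule instance that chose `δ`; its atoms are joined to `δ` by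
dependency edges, which bound their ranks. -/
theorem chosenEffect_explanation {P : Program L} {s : (r : Rule L) → r.Choice M}
    {rank : DomainAtom L M → ℕ} (hp : ∀ δ ε, P.PosDepends δ ε → rank ε ≤ rank δ)
    (hn : ∀ δ ε, P.NegDepends δ ε → rank ε < rank δ) {A B : Set (DomainAtom L M)}
    {δ : DomainAtom L M} (h : δ ∈ chosenEffect P.toList s A B) :
    ∃ pos neg : Set (DomainAtom L M),
      pos ⊆ A ∧ Disjoint neg B ∧ (∀ ε ∈ pos, rank ε ≤ rank δ) ∧ (∀ ε ∈ neg, rank ε < rank δ) ∧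
        ∀ A' B', pos ⊆ A' → Disjoint neg B' → δ ∈ chosenEffect P.toList s A' B' := by
  obtain ⟨r, hr, hh, η, hb, rfl⟩ := h
  have hr' := Finset.mem_toList.1 hr
  rw [holds_bodyFormula] at hb
  refine ⟨{ε | ∃ b ∈ r.pos, b.inst η = ε}, {ε | ∃ c ∈ r.neg, c.inst η = ε}, ?_, ?_, ?_, ?_, ?_⟩
  · rintro _ ⟨b, hb', rfl⟩
    exact hb.1 b hb'
  · refine Set.disjoint_left.2 ?_
    rintro _ ⟨c, hc, rfl⟩
    exact hb.2 c hc
  · exact fun ε hε => hp _ _ ⟨r, hr', η, _, ⟨_, List.get_mem _ _, rfl⟩, hε⟩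
  · exact fun ε hε => hn _ _ ⟨r, hr', η, _, ⟨_, List.get_mem _ _, rfl⟩, hε⟩
  · intro A' B' hA hB
    refine ⟨r, hr, hh, η, (holds_bodyFormula _ _ _ _).2 ⟨fun b hb' => hA ⟨b, hb', rfl⟩, ?_⟩, rfl⟩
    exact fun c hc => Set.disjoint_left.1 hB ⟨c, hc, rfl⟩

theorem Program.IsStableModel.isModel_andList [Nonempty M]
    (hL : ∀ n : ℕ, IsEmpty (L.Functions (n + 1))) {P : Program L}
    (hN : P.NoRecursionOverNegation M) (h : P.IsStableModel M) {C : CEE L 0}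
    {l : List (CEE L 0)} (hC : P.toList.filterMap Rule.toCEE = C :: l) :
    (CEE.andList C l).IsModel M := by
  obtain ⟨s, hs⟩ := h.exists_choice
  obtain ⟨ζ, hζ⟩ := exists_selection_of_choice hC s
  obtain ⟨rank, hp, hn⟩ := hN.exists_rank hL
  refine ⟨ζ, wellFoundedFixpoint_eq ?_ rank fun A B δ hδ => ?_, selectsProperly_andList ?_ ζ _⟩
  · have hsub : stableOp (CEE.andList C l) ζ (trueAtoms L M) ⊆ trueAtoms L M := by
      refine stableOp_subset (Set.union_subset (fun _ h => h.1) ?_)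
      rwa [hζ]
    -- The least fixpoint contains the chosen atom of each instance it satisfies, so it is closed
    -- and minimality applies.
    refine hsub.antisymm (h.2 (closed_of_chosenEffect_subset (s := s) hsub ?_ ?_) hsub)
    · rw [← hζ]
      exact Set.subset_union_right.trans (cause_stableOp _ ζ _).le
    · exact fun r hr hh η => h.not_holds hr hh η
  · simp only [hζ] at hδ ⊢
    exact chosenEffect_explanation hp hn hδ
  · intro D hD ζ η
    rw [← hC] at hD
    obtain ⟨r, -, hr⟩ := List.mem_filterMap.1 hD
    exact Rule.selectsProperly hr ζ η

/-- A set of true atoms that satisfies an instance of a rule contains the chosen head atom, if the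
program is non-overlapping and all true atoms are chosen ones. -/
theorem Program.NonOverlapping.chosen_mem {P : Program L} (hP : P.NonOverlapping M)
    {T X : Set (DomainAtom L M)} {s : (r : Rule L) → r.Choice M}
    (hT : T ⊆ chosenEffect P.toList s T T) (hX : X ⊆ T) {r : Rule L} (hr : r ∈ P)
    (hh : r.head ≠ []) {η : Fin r.numX → M} {θ : Fin r.numY → M} {i : Fin r.head.length}
    (h : (r.head.get i).inst (Fin.append η θ) ∈ X) : r.chosen (s r) hh η ∈ X := by
  suffices H : i = (s r hh η).1 ∧ θ = (s r hh η).2 by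
    rw [H.1, H.2] at h
    exact h
  by_cases hd : r.Disjunctive
  -- The head atom in `X` is true, hence chosen by some instance; since it occurs in a disjunctive
  -- rule, non-overlap makes both occurrences the same.
  · obtain ⟨r', hr', hh', η', -, he⟩ := hT (hX h)
    rcases hP ((r.head.get i).inst (Fin.append η θ)) with H | H
    · exact (H r hr i _ rfl hd).elim
    · have := @H ⟨r, i, Fin.append η θ⟩ ⟨hr, rfl⟩
        ⟨r', (s r' hh' η').1, Fin.append η' (s r' hh' η').2⟩ ⟨Finset.mem_toList.1 hr', he⟩
      obtain ⟨rfl, this⟩ := Sigma.mk.inj this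
      obtain ⟨h₁, h₂⟩ := Prod.mk.inj (eq_of_heq this)
      obtain rfl : η = η' := funext fun j => by
        simpa using congrFun h₂ (Fin.castAdd _ j)
      exact ⟨h₁, funext fun j => by simpa using congrFun h₂ (Fin.natAdd _ j)⟩
  · exact Rule.eq_of_not_disjunctive hd _ _ _ _

theorem Program.isStableModel_of_isModel_andList [Nonempty M] {P : Program L}
    (hP : P.NonOverlapping M) {C : CEE L 0} {l : List (CEE L 0)}
    (hC : P.toList.filterMap Rule.toCEE = C :: l) (h : (CEE.andList C l).IsModel M)
    (hS : ∀ φ ∈ P.toTheory.sentences, φ.Realize M) : P.IsStableModel M := by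
  obtain ⟨ζ, hW, -⟩ := h
  obtain ⟨s, hs⟩ := exists_choice_of_selection P.nodup_toList hC ζ
  obtain ⟨hS₁, hS₂⟩ := P.realize_sentences_iff.1 hS
  have hT : stableOp (CEE.andList C l) ζ (trueAtoms L M) = trueAtoms L M := by
    have := (stableOp_wellFoundedFixpoint (CEE.andList C l) ζ).1
    rwa [hW] at this
  -- The exogenous part is empty: by the sentences, every true atom has its predicate in some head.
  have hcause (A B : Set (DomainAtom L M)) :
      cause (CEE.andList C l) ζ A B = chosenEffect P.toList s A B := by
    rw [cause, hs, Set.union_eq_right]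
    exact fun δ hδ => (hδ.2 ((endogenous_iff_inHead _ hC).2 (hS₂ δ hδ.1))).elim
  have hfix : chosenEffect P.toList s (trueAtoms L M) (trueAtoms L M) = trueAtoms L M := by
    have := cause_stableOp (CEE.andList C l) ζ (trueAtoms L M)
    rwa [hT, hcause] at this
  refine ⟨closed_of_chosenEffect_subset le_rfl hfix.le hS₁, fun X hX hXT => ?_⟩
  -- `X` is a prefixpoint of the operator whose least fixpoint is the set of true atoms.
  have hX' : stableOp (CEE.andList C l) ζ (trueAtoms L M) ⊆ X := by
    refine stableOp_subset ?_
    rw [hcause]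
    rintro _ ⟨r, hr, hh, η, hb, rfl⟩
    have hr := Finset.mem_toList.1 hr
    obtain ⟨θ, a, ha, haX⟩ := hX r hr η ((r.bodyEntailed_iff hXT η).2 hb)
    obtain ⟨i, rfl⟩ := List.mem_iff_get.1 ha
    exact hP.chosen_mem hfix.ge hXT hr hh haX
  rwa [hT] at hX'

/-- With no heads at all, the sentences make every atom false, so minimality is trivial and closure
only requires that no constraint fires. -/
theorem Program.isStableModel_of_forall_head_eq_nil {P : Program L}
    (hC : P.toList.filterMap Rule.toCEE = [])
    (hS : ∀ φ ∈ P.toTheory.sentences, φ.Realize M) : P.IsStableModel M := by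
  obtain ⟨hS₁, hS₂⟩ := P.realize_sentences_iff.1 hS
  have hh : ∀ r ∈ P, r.head = [] := fun r hr =>
    r.toCEE_eq_none_iff.1 (List.filterMap_eq_nil_iff.1 hC r (Finset.mem_toList.2 hr))
  refine ⟨fun r hr η hb => ?_, fun X _ _ δ hδ => ?_⟩
  · exact (hS₁ r hr (hh r hr) η ((r.bodyEntailed_iff le_rfl η).1 hb)).elim
  · obtain ⟨r, hr, a, ha, -⟩ := hS₂ δ hδ
    simp [hh r hr] at ha

end Main

end CLog

/-- `L` is a relational vocabulary (predicate and constant symbols only), `P` an E-disjunctive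
program and `I` a structure. -/
theorem theorem2 {L : FirstOrder.Language.{u, v}} (hL : ∀ n : ℕ, IsEmpty (L.Functions (n + 1)))
    (P : CLog.Program L) (I : Type w) [Nonempty I] [L.Structure I]
    (hP : P.NonOverlapping I) (hN : P.NoRecursionOverNegation I) :
    P.IsStableModel I ↔ P.toTheory.IsModel I := by
  have hcausal : P.toTheory.causal = match P.toList.filterMap CLog.Rule.toCEE with
    | [] => ∅
    | C :: l => {CLog.CEE.andList C l} := rfl
  constructor
  · intro h
    refine ⟨?_, P.realize_sentences_iff.2 ⟨fun r hr hh η => h.not_holds hr hh η,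
      fun δ hδ => h.inHead hδ⟩⟩
    intro C hC
    rw [hcausal] at hC
    rcases hl : P.toList.filterMap CLog.Rule.toCEE with _ | ⟨D, l⟩
    · rw [hl] at hC
      exact hC.elim
    · rw [hl] at hC
      obtain rfl := hC
      exact h.isModel_andList hL hN hl
  · rintro ⟨hC, hS⟩
    rw [hcausal] at hC
    rcases hl : P.toList.filterMap CLog.Rule.toCEE with _ | ⟨D, l⟩
    · exact CLog.Program.isStableModel_of_forall_head_eq_nil hl hS
    · rw [hl] at hC
      exact CLog.Program.isStableModel_of_isModel_andList hP hl (hC _ rfl) hS
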